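/- Notation. All indices are zero-based. For $K\le D$, $u\in\mathbb{R}^K$, $v\in\mathbb{R}^D$ let $(u\star v)[d]=\frac{1}{\sqrt D}\sum_{k=0}^{K-1}u[k]\,v[(d+k)\bmod D]$, and for $z\in\mathbb{R}^D$ let $z^{\downarrow}[d]=z[D-d-1]$. A two-layer linear convolutional network on $\mathbb{R}^D$ with kernel size $K$ ($1\le K\le D$), $C\ge 1$ output channels and weights $U\in\mathbb{R}^{K\times C}$, $V\in\mathbb{R}^{D\times C}$ realizes the linear predictor $$w(U,V)=\sum_{c=0}^{C-1}\bigl(U[:,c]\star V[:,c]^{\downarrow}\bigr)^{\downarrow}\in\mathbb{R}^D .$$ For $w\in\mathbb{R}^D$ the induced regularizer is $$\mathcal{R}_{K,C}(w)=\mathcal{R}^{(D)}_{K,C}(w)=\min\bigl\{\|U\|_F^2+\|V\|_F^2 : U\in\mathbb{R}^{K\times C},\ V\in\mathbb{R}^{D\times C},\ w(U,V)=w\bigr\},$$ and $\mathcal{R}^{(P)}_{K,C}$ denotes the same quantity with $P$ in place of $D$. For $a\in\mathbb{R}^n$, $\hat a\in\mathbb{C}^n$ denotes its unitary discrete Fourier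 transform in dimension $n$, $\hat a[d]=\frac{1}{\sqrt n}\sum_{l=0}^{n-1}e^{-2\pi i dl/n}a[l]$. Lemma 4. Let $D\ge 1$, let $P$ be a positive divisor of $D$, let $p\in\mathbb{R}^P$, and let $w(p)=[p,p,\ldots,p]\in\mathbb{R}^D$ be the vector consisting of $D/P$ copies of $p$. The minima above are attained, and the following holds. (a) For every $1\le K\le P$ and every $C\ge 1$, $$\mathcal{R}_{K,C}(w(p))=\frac{D}{P}\cdot \mathcal{R}^{(P)}_{K,1}(p).$$ (b) For every $K$ with $P\le K\le D$ and $K=P\cdot T$ for an integer $T$, and every $C\ge 1$, $$\mathcal{R}_{K,C}(w(p))=\frac{2D}{\sqrt{T}\,P}\,\|\hat p\|_1=2\sqrt{\frac{D}{K}}\,\|\widehat{w(p)}\|_1 .$$ -/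

import Mathlib

noncomputable section

/-- Circular convolution (as used in the neural networks literature) of a kernel `u ∈ ℝ^K` with
`v ∈ ℝ^D`: `(u ⋆ v)[d] = (1/√D) ∑_{k<K} u[k] v[(d + k) mod D]`. -/
def circConv {K D : ℕ} (u : Fin K → ℝ) (v : Fin D → ℝ) : Fin D → ℝ := fun d =>
  1 / Real.sqrt (D : ℝ) * ∑ k : Fin K, u k * v ⟨(d.val + k.val) % D, Nat.mod_lt _ d.pos⟩

/-- The flipped vector `z↓[d] = z[D - d - 1]`. -/
def flipVec {D : ℕ} (z : Fin D → ℝ) : Fin D → ℝ := fun d => z (Fin.rev d)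

/-- The linear predictor realised by the two-layer linear convolutional network with first-layer
weights `U ∈ ℝ^{K×C}` and second-layer weights `V ∈ ℝ^{D×C}`:
`w(U,V) = ∑_c (U[:,c] ⋆ V[:,c]↓)↓`. -/
def predictor {D K C : ℕ} (U : Matrix (Fin K) (Fin C) ℝ) (V : Matrix (Fin D) (Fin C) ℝ) :
    Fin D → ℝ :=
  ∑ c : Fin C, flipVec (circConv (fun k => U k c) (flipVec (fun d => V d c)))

/-- The squared Frobenius norm of a real matrix. -/
def frobSq {m n : ℕ} (A : Matrix (Fin m) (Fin n) ℝ) : ℝ := ∑ i, ∑ j, A i j ^ 2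

/-- The values `‖U‖² + ‖V‖²` over all networks with kernel size `K` and `C` output channels that
realise the linear predictor `w ∈ ℝ^D`. -/
def repCosts {D : ℕ} (K C : ℕ) (w : Fin D → ℝ) : Set ℝ :=
  {r | ∃ (U : Matrix (Fin K) (Fin C) ℝ) (V : Matrix (Fin D) (Fin C) ℝ),
    predictor U V = w ∧ r = frobSq U + frobSq V}

/-- The induced regularizer (representation cost) `R_{K,C}(w)` of `w ∈ ℝ^D`; the ambient dimension
`D` is implicit in the type of `w`. -/
def inducedReg {D : ℕ} (K C : ℕ) (w : Fin D → ℝ) : ℝ := sInf (repCosts K C w)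

/-- The unitary discrete Fourier transform on `ℝ^D`:
`â[d] = (1/√D) ∑_l e^{-2πi d l / D} a[l]`. -/
def unitaryDFT {D : ℕ} (a : Fin D → ℝ) : Fin D → ℂ := fun d =>
  1 / (Real.sqrt (D : ℝ) : ℂ) *
    ∑ l : Fin D,
      Complex.exp (-2 * (Real.pi : ℂ) * Complex.I * (d.val : ℂ) * (l.val : ℂ) / (D : ℂ)) *
        (a l : ℂ)

/-- The `ℓ₁` norm of a complex vector. -/
def l1Norm {D : ℕ} (z : Fin D → ℂ) : ℝ := ∑ d, ‖z d‖

/-- The patterned vector `w(p) = [p, p, …, p] ∈ ℝ^D` built from `p ∈ ℝ^P`, where `P ∣ D`. -/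
def patterned {P D : ℕ} (hPD : P ∣ D) (p : Fin P → ℝ) : Fin D → ℝ := fun d =>
  p ⟨d.val % P, Nat.mod_lt _ (Nat.pos_of_dvd_of_pos hPD d.pos)⟩

end

/-! ### Single-channel costs and merging of channels. -/

section Merging

open Finset

/-! Extra channels never lower the cost, so one channel suffices. Rotating two channels by an
orthogonal matrix keeps their summed convolution and cost, and so does shifting leading zeros out of
a kernel. Among pairs of bounded cost, one maximising the squared leading kernel entries must, after
rotation, have a zero second kernel (`exists_merge_two`).

For one channel, periodising and summing over residue classes mod `P` pass between lengths `M * P`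
and `P`. Both intertwine convolution, and Cauchy–Schwarz bounds the summed norm, so repeating `p`
multiplies the cost by `M` (`isLeast_singleCosts_patterned`) and a kernel wrapping `T` times divides
it by `√T` (`isLeast_singleCosts_mul`). At full kernel length the Fourier transform decouples the
problem and AM–GM at each frequency gives `2‖p̂‖₁` (`isLeast_singleCosts_self`). -/

/-- One channel of the network: `u` convolved with `v`, in the orientation used by `predictor`. -/
noncomputable def channelConv {K D : ℕ} (u : Fin K → ℝ) (v : Fin D → ℝ) : Fin D → ℝ :=
  flipVec (circConv u (flipVec v))

/-- The squared Euclidean norm. -/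
noncomputable def sqNorm {n : ℕ} (v : Fin n → ℝ) : ℝ := ∑ i, v i ^ 2

/-- The costs of the realisations of `w` by a network with a single channel. -/
def singleCosts {D : ℕ} (K : ℕ) (w : Fin D → ℝ) : Set ℝ :=
  {r | ∃ (u : Fin K → ℝ) (v : Fin D → ℝ), channelConv u v = w ∧ r = sqNorm u + sqNorm v}

lemma sqNorm_nonneg {n : ℕ} (v : Fin n → ℝ) : 0 ≤ sqNorm v :=
  Finset.sum_nonneg fun _ _ => sq_nonneg _

lemma sqNorm_smul {n : ℕ} (a : ℝ) (v : Fin n → ℝ) : sqNorm (a • v) = a ^ 2 * sqNorm v := by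
  simp [sqNorm, mul_pow, Finset.mul_sum]

lemma continuous_sqNorm {n : ℕ} : Continuous (sqNorm : (Fin n → ℝ) → ℝ) := by
  unfold sqNorm; fun_prop

/-- The two flips turn the index `d + k` into `d - k`, leaving ordinary cyclic convolution. -/
lemma channelConv_apply {K D : ℕ} [NeZero D] (u : Fin K → ℝ) (v : Fin D → ℝ) (d : Fin D) :
    channelConv u v d = 1 / √(D : ℝ) * ∑ k : Fin K, u k * v (d - Fin.ofNat D k) := by
  unfold channelConv flipVec circConv
  congr 1
  refine Finset.sum_congr rfl fun k _ => ?_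
  congr 2
  have hD : 0 < D := d.pos
  have key : Fin.rev (⟨(d.rev.val + k.val) % D, Nat.mod_lt _ hD⟩ : Fin D) + Fin.ofNat D k = d := by
    apply Fin.ext
    simp only [Fin.val_add, Fin.val_rev, Fin.val_ofNat]
    have h1 := Nat.mod_lt (D - (d.val + 1) + k.val) hD
    have h2 := Nat.div_add_mod (D - (d.val + 1) + k.val) D
    set q := (D - (d.val + 1) + k.val) / D
    set r := (D - (d.val + 1) + k.val) % D
    have hd := d.isLt
    rw [Nat.add_mod_mod]
    have : D - (r + 1) + k.val = d.val + D * q := by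
      zify [show r + 1 ≤ D from h1, show d.val + 1 ≤ D from hd] at h2 ⊢
      linarith
    rw [this, Nat.add_mul_mod_self_left, Nat.mod_eq_of_lt hd]
  exact congrArg v (eq_sub_of_add_eq key)

lemma channelConv_smul_left {K D : ℕ} [NeZero D] (a : ℝ) (u : Fin K → ℝ) (v : Fin D → ℝ) :
    channelConv (a • u) v = a • channelConv u v := by
  ext d
  simp only [channelConv_apply, Pi.smul_apply, smul_eq_mul, Finset.mul_sum]
  exact Finset.sum_congr rfl fun _ _ => by ring

lemma channelConv_smul_right {K D : ℕ} [NeZero D] (a : ℝ) (u : Fin K → ℝ) (v : Fin D → ℝ) :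
    channelConv u (a • v) = a • channelConv u v := by
  ext d
  simp only [channelConv_apply, Pi.smul_apply, smul_eq_mul, Finset.mul_sum]
  exact Finset.sum_congr rfl fun _ _ => by ring

lemma channelConv_add_left {K D : ℕ} [NeZero D] (u u' : Fin K → ℝ) (v : Fin D → ℝ) :
    channelConv (u + u') v = channelConv u v + channelConv u' v := by
  ext d
  simp only [channelConv_apply, Pi.add_apply, add_mul, Finset.sum_add_distrib, mul_add]

lemma channelConv_add_right {K D : ℕ} [NeZero D] (u : Fin K → ℝ) (v v' : Fin D → ℝ) :
    channelConv u (v + v') = channelConv u v + channelConv u v' := by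
  ext d
  simp only [channelConv_apply, Pi.add_apply, mul_add, Finset.sum_add_distrib]

lemma channelConv_zero_left {K D : ℕ} [NeZero D] (v : Fin D → ℝ) :
    channelConv (0 : Fin K → ℝ) v = 0 := by
  ext d; simp [channelConv_apply]

lemma continuous_channelConv {K D : ℕ} [NeZero D] :
    Continuous fun x : (Fin K → ℝ) × (Fin D → ℝ) => channelConv x.1 x.2 := by
  refine continuous_pi fun d => ?_
  simp only [channelConv_apply]
  fun_prop

lemma isCompact_sqNorm_le {n : ℕ} (B : ℝ) : IsCompact {v : Fin n → ℝ | sqNorm v ≤ B} := by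
  refine (isCompact_closedBall (0 : Fin n → ℝ) √B).of_isClosed_subset
    (isClosed_le continuous_sqNorm continuous_const) fun v hv => ?_
  rw [mem_closedBall_zero_iff, pi_norm_le_iff_of_nonneg (Real.sqrt_nonneg _)]
  intro i
  rw [Real.norm_eq_abs]
  refine Real.abs_le_sqrt (le_trans ?_ hv)
  exact Finset.single_le_sum (f := fun i => v i ^ 2) (fun _ _ => sq_nonneg _) (mem_univ i)

lemma isCompact_cost_le {K D : ℕ} (B : ℝ) :
    IsCompact {x : (Fin K → ℝ) × (Fin D → ℝ) | sqNorm x.1 + sqNorm x.2 ≤ B} := by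
  refine ((isCompact_sqNorm_le B).prod (isCompact_sqNorm_le B)).of_isClosed_subset
    (isClosed_le ((continuous_sqNorm.comp continuous_fst).add
      (continuous_sqNorm.comp continuous_snd)) continuous_const) fun x hx => ?_
  have h1 := sqNorm_nonneg x.1
  have h2 := sqNorm_nonneg x.2
  have h3 : sqNorm x.1 + sqNorm x.2 ≤ B := hx
  exact ⟨by show sqNorm x.1 ≤ B; linarith, by show sqNorm x.2 ≤ B; linarith⟩

/-- The single-channel representation cost is attained. -/
lemma exists_isLeast_singleCosts {K D : ℕ} [NeZero D] [NeZero K] (w : Fin D → ℝ) :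
    ∃ r, IsLeast (singleCosts K w) r := by
  have hD : (0 : ℝ) < D := by exact_mod_cast NeZero.pos D
  have hs : √(D : ℝ) ≠ 0 := (Real.sqrt_pos.2 hD).ne'
  -- A scaled delta kernel realises `w`; its cost bounds the search to a compact set.
  set u₀ : Fin K → ℝ := fun k => if k = 0 then √(D : ℝ) else 0
  have h₀ : channelConv u₀ w = w := by
    ext d
    rw [channelConv_apply, Finset.sum_eq_single 0]
    · have : Fin.ofNat D ((0 : Fin K) : ℕ) = 0 := by apply Fin.ext; simp
      rw [this]
      simp only [u₀, if_true, sub_zero]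
      field_simp
    · intro k _ hk; simp [u₀, hk]
    · simp
  set B := sqNorm u₀ + sqNorm w
  have hc : IsCompact ({x : (Fin K → ℝ) × (Fin D → ℝ) | sqNorm x.1 + sqNorm x.2 ≤ B} ∩
      {x | channelConv x.1 x.2 = w}) :=
    (isCompact_cost_le B).inter_right (isClosed_eq continuous_channelConv continuous_const)
  obtain ⟨x, ⟨hxB, hxw⟩, hx⟩ := hc.exists_isMinOn ⟨(u₀, w), le_refl B, h₀⟩
    (f := fun x => sqNorm x.1 + sqNorm x.2)
    ((continuous_sqNorm.comp continuous_fst).add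
      (continuous_sqNorm.comp continuous_snd)).continuousOn
  refine ⟨_, ⟨x.1, x.2, hxw, rfl⟩, ?_⟩
  rintro _ ⟨u, v, huv, rfl⟩
  rcases le_total (sqNorm u + sqNorm v) B with h | h
  · exact hx (show (u, v) ∈ _ from ⟨h, huv⟩)
  · exact le_trans hxB h

/-- A kernel whose entries before `k` vanish can be moved to the left by `k`, at no cost. -/
lemma exists_shift {K D : ℕ} [NeZero D] [NeZero K] (u : Fin K → ℝ) (v : Fin D → ℝ) (k : Fin K)
    (hk : ∀ i < k, u i = 0) :
    ∃ (u' : Fin K → ℝ) (v' : Fin D → ℝ), channelConv u' v' = channelConv u v ∧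
      sqNorm u' = sqNorm u ∧ sqNorm v' = sqNorm v ∧ u' 0 = u k := by
  -- The shift is cyclic in `Fin K`, but only vanishing entries wrap around; translating `v`
  -- compensates.
  refine ⟨fun j => u (j + k), fun d => v (d - Fin.ofNat D k), ?_, ?_, ?_, by simp⟩
  · ext d
    rw [channelConv_apply, channelConv_apply]
    congr 1
    rw [← Equiv.sum_comp (Equiv.subRight k)]
    refine Finset.sum_congr rfl fun i _ => ?_
    simp only [Equiv.subRight_apply, sub_add_cancel]
    rcases lt_or_ge i k with h | h
    · simp [hk i h]
    · congr 2
      rw [sub_sub]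
      congr 1
      apply Fin.ext
      have hik : (i - k).val = i.val - k.val := Fin.sub_val_of_le h
      have : k.val ≤ i.val := h
      simp only [Fin.val_add, Fin.val_ofNat, Nat.add_mod_mod, Nat.mod_add_mod, hik]
      congr 1; omega
  · exact Equiv.sum_comp (Equiv.addRight k) fun i => u i ^ 2
  · exact Equiv.sum_comp (Equiv.subRight (Fin.ofNat D k)) fun i => v i ^ 2

lemma exists_rotation (a b : ℝ) : ∃ c s : ℝ, c ^ 2 + s ^ 2 = 1 ∧ c * b - s * a = 0 := by
  rcases eq_or_ne (a ^ 2 + b ^ 2) 0 with h | h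
  · have hb : b = 0 := by nlinarith [sq_nonneg a, sq_nonneg b]
    have ha : a = 0 := by nlinarith [sq_nonneg a, sq_nonneg b]
    exact ⟨1, 0, by norm_num, by simp [ha, hb]⟩
  · have hp : 0 < a ^ 2 + b ^ 2 := lt_of_le_of_ne (by positivity) h.symm
    have hs := Real.sq_sqrt hp.le
    have hne : √(a ^ 2 + b ^ 2) ≠ 0 := (Real.sqrt_pos.2 hp).ne'
    refine ⟨a / √(a ^ 2 + b ^ 2), b / √(a ^ 2 + b ^ 2), ?_, by ring⟩
    rw [div_pow, div_pow, hs, ← add_div, div_self h]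

lemma sqNorm_rotate {n : ℕ} {c s : ℝ} (h : c ^ 2 + s ^ 2 = 1) (u u' : Fin n → ℝ) :
    sqNorm (c • u + s • u') + sqNorm (c • u' - s • u) = sqNorm u + sqNorm u' := by
  unfold sqNorm
  rw [← Finset.sum_add_distrib, ← Finset.sum_add_distrib]
  refine Finset.sum_congr rfl fun i _ => ?_
  simp only [Pi.add_apply, Pi.sub_apply, Pi.smul_apply, smul_eq_mul]
  linear_combination (u i ^ 2 + u' i ^ 2) * h

lemma channelConv_rotate {K D : ℕ} [NeZero D] {c s : ℝ} (h : c ^ 2 + s ^ 2 = 1)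
    (u u' : Fin K → ℝ) (v v' : Fin D → ℝ) :
    channelConv (c • u + s • u') (c • v + s • v') + channelConv (c • u' - s • u) (c • v' - s • v)
      = channelConv u v + channelConv u' v' := by
  simp only [sub_eq_add_neg, ← neg_smul, channelConv_add_left, channelConv_add_right,
    channelConv_smul_left, channelConv_smul_right]
  ext d
  simp only [Pi.add_apply, Pi.smul_apply, smul_eq_mul]
  linear_combination (channelConv u v d + channelConv u' v' d) * h

/-- Two channels can be merged into one without increasing the cost. -/
lemma exists_merge_two {K D : ℕ} [NeZero D] [NeZero K] (u₁ u₂ : Fin K → ℝ) (v₁ v₂ : Fin D → ℝ) :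
    ∃ (u : Fin K → ℝ) (v : Fin D → ℝ), channelConv u v = channelConv u₁ v₁ + channelConv u₂ v₂ ∧
      sqNorm u + sqNorm v ≤ (sqNorm u₁ + sqNorm v₁) + (sqNorm u₂ + sqNorm v₂) := by
  set w := channelConv u₁ v₁ + channelConv u₂ v₂
  set B := (sqNorm u₁ + sqNorm v₁) + (sqNorm u₂ + sqNorm v₂)
  let cost : (Fin K → ℝ) × (Fin D → ℝ) → ℝ := fun x => sqNorm x.1 + sqNorm x.2
  have hcost : Continuous cost := (continuous_sqNorm.comp continuous_fst).add
      (continuous_sqNorm.comp continuous_snd)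
  have hcost0 : ∀ x, 0 ≤ cost x := fun x => add_nonneg (sqNorm_nonneg _) (sqNorm_nonneg _)
  let S : Set (((Fin K → ℝ) × (Fin D → ℝ)) × ((Fin K → ℝ) × (Fin D → ℝ))) :=
    {x | cost x.1 + cost x.2 ≤ B ∧
    channelConv x.1.1 x.1.2 + channelConv x.2.1 x.2.2 = w}
  have hS : IsCompact S := by
    refine ((isCompact_cost_le B).prod (isCompact_cost_le B)).of_isClosed_subset
      ((isClosed_le ((hcost.comp continuous_fst).add (hcost.comp continuous_snd))
        continuous_const).inter (isClosed_eq ((continuous_channelConv.comp continuous_fst).add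
          (continuous_channelConv.comp continuous_snd)) continuous_const)) fun x hx => ?_
    have h1 := hcost0 x.1
    have h2 := hcost0 x.2
    have h3 : cost x.1 + cost x.2 ≤ B := hx.1
    exact ⟨by show cost x.1 ≤ B; linarith, by show cost x.2 ≤ B; linarith⟩
  -- Extremal choice: the pair with the most mass in the leading kernel entries.
  obtain ⟨⟨⟨a₁, b₁⟩, ⟨a₂, b₂⟩⟩, ⟨hxB, hxw⟩, hmax⟩ := hS.exists_isMaxOn
    ⟨((u₁, v₁), (u₂, v₂)), le_refl B, rfl⟩ (f := fun x => x.1.1 0 ^ 2 + x.2.1 0 ^ 2)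
    (Continuous.continuousOn (by fun_prop))
  -- This rotation moves all leading mass into the first kernel, keeping the pair extremal.
  obtain ⟨c, s, hcs, h0⟩ := exists_rotation (a₁ 0) (a₂ 0)
  have hconv := channelConv_rotate hcs a₁ a₂ b₁ b₂
  have hna := sqNorm_rotate hcs a₁ a₂
  have hnb := sqNorm_rotate hcs b₁ b₂
  have hval : (c • a₁ + s • a₂) 0 ^ 2 = a₁ 0 ^ 2 + a₂ 0 ^ 2 := by
    simp only [Pi.add_apply, Pi.smul_apply, smul_eq_mul]
    linear_combination (a₁ 0 ^ 2 + a₂ 0 ^ 2) * hcs - (c * a₂ 0 - s * a₁ 0) * h0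
  set x₁ := c • a₁ + s • a₂
  set x₂ := c • a₂ - s • a₁
  set y₁ := c • b₁ + s • b₂
  set y₂ := c • b₂ - s • b₁
  simp only [cost] at hxB
  have hx₂ : x₂ = 0 := by
    by_contra hne
    obtain ⟨i, hi⟩ := Function.ne_iff.1 hne
    obtain ⟨k, hk, hkmin⟩ := WellFounded.has_min (wellFounded_lt (α := Fin K))
      {i | x₂ i ≠ 0} ⟨i, hi⟩
    -- Shifting the first nonzero entry of `x₂` into leading position would exceed the maximum.
    obtain ⟨x', y', h1, h2, h3, h4⟩ := exists_shift x₂ y₂ k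
      fun i hi => by by_contra h; exact hkmin i h hi
    have hm := hmax (show ((x₁, y₁), (x', y')) ∈ S from
      ⟨by simp only [cost]; linarith, by simp only [h1, hconv]; exact hxw⟩)
    simp only [Set.mem_ofPred_eq] at hm
    rw [hval, h4] at hm
    have : 0 < x₂ k ^ 2 := by have : x₂ k ≠ 0 := hk; positivity
    linarith
  refine ⟨x₁, y₁, ?_, ?_⟩
  · rw [hx₂, channelConv_zero_left, add_zero] at hconv
    rw [hconv]; exact hxw
  · have := sqNorm_nonneg x₂
    have := sqNorm_nonneg y₂
    linarith

/-- Any number of channels can be merged into one without increasing the cost. -/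
lemma exists_merge {ι : Type*} {K D : ℕ} [NeZero D] [NeZero K] (s : Finset ι)
    (u : ι → Fin K → ℝ) (v : ι → Fin D → ℝ) :
    ∃ (u' : Fin K → ℝ) (v' : Fin D → ℝ), channelConv u' v' = ∑ c ∈ s, channelConv (u c) (v c) ∧
      sqNorm u' + sqNorm v' ≤ ∑ c ∈ s, (sqNorm (u c) + sqNorm (v c)) := by
  classical
  induction s using Finset.induction_on with
  | empty => exact ⟨0, 0, by simp [channelConv_zero_left], by simp [sqNorm]⟩
  | insert a s ha ih =>
    obtain ⟨u₁, v₁, h1, h2⟩ := ih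
    obtain ⟨u₂, v₂, h3, h4⟩ := exists_merge_two (u a) u₁ (v a) v₁
    refine ⟨u₂, v₂, ?_, ?_⟩
    · rw [Finset.sum_insert ha, h3, h1]
    · rw [Finset.sum_insert ha]; linarith

lemma frobSq_eq_sum_sqNorm {m n : ℕ} (A : Matrix (Fin m) (Fin n) ℝ) :
    frobSq A = ∑ c, sqNorm fun k => A k c := Finset.sum_comm

/-- Zero channels pad a single-channel optimum up to `C`; merging gives the lower bound. -/
lemma isLeast_repCosts {K D C : ℕ} [NeZero D] [NeZero K] (hC : 1 ≤ C) {w : Fin D → ℝ} {r : ℝ}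
    (h : IsLeast (singleCosts K w) r) : IsLeast (repCosts K C w) r := by
  obtain ⟨⟨u, v, huv, rfl⟩, hmin⟩ := h
  have : NeZero C := ⟨by omega⟩
  have hz : ∀ {n : ℕ} (a : Fin n → ℝ), frobSq (Matrix.of fun k (c : Fin C) => if c = 0 then a k else 0)
      = sqNorm a := by
    intro n a
    rw [frobSq_eq_sum_sqNorm, Finset.sum_eq_single 0]
    · simp
    · intro c _ hc; simp [hc, sqNorm]
    · simp
  refine ⟨⟨Matrix.of fun k c => if c = 0 then u k else 0,
    Matrix.of fun d c => if c = 0 then v d else 0, ?_, ?_⟩, ?_⟩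
  · unfold predictor
    rw [Finset.sum_eq_single 0]
    · simp only [Matrix.of_apply, if_true]
      exact huv
    · intro c _ hc
      simp only [Matrix.of_apply, hc, if_false]
      exact channelConv_zero_left _
    · simp
  · rw [hz, hz]
  · rintro _ ⟨U, V, hUV, rfl⟩
    obtain ⟨u', v', h1, h2⟩ := exists_merge Finset.univ (fun c k => U k c) (fun c d => V d c)
    rw [frobSq_eq_sum_sqNorm, frobSq_eq_sum_sqNorm, ← Finset.sum_add_distrib]
    exact le_trans (hmin ⟨u', v', h1.trans hUV, rfl⟩) h2

lemma isLeast_repCosts_inducedReg {K D C : ℕ} [NeZero D] [NeZero K] (hC : 1 ≤ C) {w : Fin D → ℝ}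
    {r : ℝ} (h : IsLeast (singleCosts K w) r) :
    IsLeast (repCosts K C w) (inducedReg K C w) ∧ inducedReg K C w = r := by
  have h' := isLeast_repCosts hC h
  have : inducedReg K C w = r := h'.csInf_eq
  exact ⟨this ▸ h', this⟩

end Merging

/-! ### Periodisation and summation over residue classes. -/

section Periodic

open Finset

lemma ofNat_val_sub {P D : ℕ} [NeZero P] [NeZero D] (hPD : P ∣ D) (d : Fin D) (k : ℕ) :
    Fin.ofNat P (d - Fin.ofNat D k).val = Fin.ofNat P d.val - Fin.ofNat P k := by
  rw [eq_sub_iff_add_eq]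
  have h : (d - Fin.ofNat D k) + Fin.ofNat D k = d := sub_add_cancel _ _
  conv_rhs => rw [← h]
  apply Fin.ext
  simp only [Fin.val_add, Fin.val_ofNat, Nat.mod_mod_of_dvd _ hPD, Nat.add_mod_mod,
    Nat.mod_add_mod]

lemma patterned_apply {P D : ℕ} [NeZero P] (hPD : P ∣ D) (p : Fin P → ℝ) (d : Fin D) :
    patterned hPD p d = p (Fin.ofNat P d.val) := rfl

lemma ofNat_finProdFinEquiv {M P : ℕ} [NeZero P] (x : Fin M × Fin P) :
    Fin.ofNat P (finProdFinEquiv x).val = x.2 := by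
  apply Fin.ext
  simp [finProdFinEquiv, Nat.mod_eq_of_lt x.2.isLt]

/-- The sum of the entries of a vector over a residue class. -/
noncomputable def residueSum {P M : ℕ} (v : Fin (M * P) → ℝ) : Fin P → ℝ :=
  fun j => ∑ m : Fin M, v (finProdFinEquiv (m, j))

lemma residueSum_eq {P M : ℕ} [NeZero P] (v : Fin (M * P) → ℝ) (j : Fin P) :
    residueSum v j = ∑ d, if Fin.ofNat P d.val = j then v d else 0 := by
  rw [← Equiv.sum_comp finProdFinEquiv, Fintype.sum_prod_type]
  simp only [ofNat_finProdFinEquiv]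
  simp [residueSum]

/-- Cauchy–Schwarz in each residue class. -/
lemma sqNorm_residueSum_le {P M : ℕ} (v : Fin (M * P) → ℝ) :
    sqNorm (residueSum v) ≤ M * sqNorm v := by
  have h : sqNorm v = ∑ j : Fin P, ∑ m : Fin M, v (finProdFinEquiv (m, j)) ^ 2 := by
    unfold sqNorm
    rw [← Equiv.sum_comp finProdFinEquiv, Fintype.sum_prod_type_right]
  rw [h, Finset.mul_sum]
  refine Finset.sum_le_sum fun j _ => ?_
  have h := sq_sum_le_card_mul_sum_sq (s := univ) (f := fun m : Fin M => v (finProdFinEquiv (m, j)))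
  rw [Finset.card_univ, Fintype.card_fin] at h
  exact h

lemma sqNorm_patterned {P M : ℕ} [NeZero P] (q : Fin P → ℝ) :
    sqNorm (patterned (Dvd.intro_left M rfl) q : Fin (M * P) → ℝ) = M * sqNorm q := by
  unfold sqNorm
  rw [← Equiv.sum_comp finProdFinEquiv, Fintype.sum_prod_type]
  simp only [patterned_apply, ofNat_finProdFinEquiv]
  simp

lemma residueSum_patterned {P M : ℕ} [NeZero P] (q : Fin P → ℝ) :
    residueSum (patterned (Dvd.intro_left M rfl) q : Fin (M * P) → ℝ) = (M : ℝ) • q := by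
  ext j
  simp only [residueSum, patterned_apply, ofNat_finProdFinEquiv]
  simp

lemma channelConv_patterned {K P M : ℕ} [NeZero P] [NeZero M] (u : Fin K → ℝ) (q : Fin P → ℝ) :
    √(M : ℝ) • channelConv u (patterned (Dvd.intro_left M rfl) q : Fin (M * P) → ℝ) =
      patterned (Dvd.intro_left M rfl) (channelConv u q) := by
  have hM : √(M : ℝ) ≠ 0 := (Real.sqrt_pos.2 (by exact_mod_cast NeZero.pos M)).ne'
  have hP : √(P : ℝ) ≠ 0 := (Real.sqrt_pos.2 (by exact_mod_cast NeZero.pos P)).ne'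
  ext d
  simp only [Pi.smul_apply, smul_eq_mul, patterned_apply, channelConv_apply,
    ofNat_val_sub (Dvd.intro_left M rfl : P ∣ M * P)]
  rw [Nat.cast_mul, Real.sqrt_mul (Nat.cast_nonneg _)]
  field_simp

/-- Summing over residue classes commutes with translation; `√M` is the ratio of the two
normalisations. -/
lemma channelConv_residueSum_right {K P M : ℕ} [NeZero P] [NeZero M] (u : Fin K → ℝ)
    (v : Fin (M * P) → ℝ) :
    channelConv u (residueSum v) = √(M : ℝ) • residueSum (channelConv u v) := by
  have hM : √(M : ℝ) ≠ 0 := (Real.sqrt_pos.2 (by exact_mod_cast NeZero.pos M)).ne'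
  have hP : √(P : ℝ) ≠ 0 := (Real.sqrt_pos.2 (by exact_mod_cast NeZero.pos P)).ne'
  have hshift : ∀ (j : Fin P) (k : ℕ), residueSum v (j - Fin.ofNat P k) =
      residueSum (fun d => v (d - Fin.ofNat (M * P) k)) j := by
    intro j k
    rw [residueSum_eq, residueSum_eq, ← Equiv.sum_comp (Equiv.subRight (Fin.ofNat (M * P) k))]
    simp only [Equiv.subRight_apply, ofNat_val_sub (Dvd.intro_left M rfl : P ∣ M * P),
      sub_left_inj]
  ext j
  simp only [Pi.smul_apply, smul_eq_mul, channelConv_apply, hshift]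
  simp only [residueSum, channelConv_apply, ← Finset.mul_sum]
  rw [Finset.sum_comm, Nat.cast_mul, Real.sqrt_mul (Nat.cast_nonneg _)]
  simp only [Finset.mul_sum]
  refine Finset.sum_congr rfl fun k _ => Finset.sum_congr rfl fun m _ => ?_
  field_simp

/-- A kernel longer than the signal wraps around, so only its residue-class sums matter. -/
lemma channelConv_residueSum_left {P T : ℕ} [NeZero P] (u : Fin (T * P) → ℝ) (v : Fin P → ℝ) :
    channelConv (residueSum u) v = channelConv u v := by
  ext d
  rw [channelConv_apply, channelConv_apply]
  congr 1
  rw [← Equiv.sum_comp finProdFinEquiv, Fintype.sum_prod_type_right]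
  refine Finset.sum_congr rfl fun j _ => ?_
  simp only [residueSum, ofNat_finProdFinEquiv, Finset.sum_mul]
  simp

/-- The cost of a patterned vector is the cost of the pattern times the number of copies. -/
lemma isLeast_singleCosts_patterned {K P M : ℕ} [NeZero P] [NeZero M] {p : Fin P → ℝ} {r : ℝ}
    (h : IsLeast (singleCosts K p) r) :
    IsLeast (singleCosts K (patterned (Dvd.intro_left M rfl) p : Fin (M * P) → ℝ)) (M * r) := by
  obtain ⟨⟨u, q, huq, rfl⟩, hmin⟩ := h
  have hM0 : (0 : ℝ) < M := by exact_mod_cast NeZero.pos M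
  have hs : √(M : ℝ) ≠ 0 := (Real.sqrt_pos.2 hM0).ne'
  have hsq : √(M : ℝ) ^ 2 = M := Real.sq_sqrt hM0.le
  constructor
  · refine ⟨√(M : ℝ) • u, patterned (Dvd.intro_left M rfl) q, ?_, ?_⟩
    · rw [channelConv_smul_left, channelConv_patterned, huq]
    · rw [sqNorm_smul, sqNorm_patterned, hsq]; ring
  · rintro _ ⟨u', v, huv, rfl⟩
    -- Averaging `v` over the copies turns a realisation of the patterned vector into one of `p`.
    have key : channelConv ((√(M : ℝ))⁻¹ • u') ((M : ℝ)⁻¹ • residueSum v) = p := by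
      rw [channelConv_smul_left, channelConv_smul_right, channelConv_residueSum_right, huv,
        residueSum_patterned, smul_smul, smul_smul, smul_smul]
      rw [show (√(M : ℝ))⁻¹ * (M : ℝ)⁻¹ * √(M : ℝ) * M = 1 by field_simp, one_smul]
    have h1 := hmin ⟨_, _, key, rfl⟩
    have h2 := sqNorm_residueSum_le v
    rw [sqNorm_smul, sqNorm_smul, inv_pow, hsq] at h1
    calc M * (sqNorm u + sqNorm q) ≤ M * ((M : ℝ)⁻¹ * sqNorm u' +
          (M : ℝ)⁻¹ ^ 2 * sqNorm (residueSum v)) := by gcongr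
      _ ≤ M * ((M : ℝ)⁻¹ * sqNorm u' + (M : ℝ)⁻¹ ^ 2 * (M * sqNorm v)) := by gcongr
      _ = sqNorm u' + sqNorm v := by field_simp

/-- The cost of a vector of length `P`, for kernels that wrap around `T` times. -/
lemma isLeast_singleCosts_mul {P T : ℕ} [NeZero P] [NeZero T] {p : Fin P → ℝ} {r : ℝ}
    (h : IsLeast (singleCosts P p) r) : IsLeast (singleCosts (T * P) p) (r / √(T : ℝ)) := by
  obtain ⟨⟨u, v, huv, rfl⟩, hmin⟩ := h
  have hT0 : (0 : ℝ) < T := by exact_mod_cast NeZero.pos T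
  -- With `τ = T^(1/4)`, spreading `u` evenly over `T` copies and rebalancing the factors scales
  -- both squared norms by `1/τ²`.
  obtain ⟨τ, hτ, hτ2⟩ : ∃ τ : ℝ, 0 < τ ∧ √(T : ℝ) = τ ^ 2 :=
    ⟨√√(T : ℝ), by positivity, (Real.sq_sqrt (Real.sqrt_nonneg _)).symm⟩
  have hτ4 : (T : ℝ) = τ ^ 4 := by
    rw [← Real.sq_sqrt hT0.le, hτ2]; ring
  rw [hτ2]
  constructor
  · refine ⟨(τ ^ 3)⁻¹ • patterned (Dvd.intro_left T rfl) u, τ⁻¹ • v, ?_, ?_⟩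
    · rw [← channelConv_residueSum_left, show residueSum ((τ ^ 3)⁻¹ •
        (patterned (Dvd.intro_left T rfl) u : Fin (T * P) → ℝ)) = τ • u from ?_,
        channelConv_smul_left, channelConv_smul_right, smul_smul, mul_inv_cancel₀ hτ.ne',
        one_smul, huv]
      ext j
      have := congrFun (residueSum_patterned (M := T) u) j
      simp only [residueSum, Pi.smul_apply, smul_eq_mul, ← Finset.mul_sum] at this ⊢
      rw [this, hτ4]
      field_simp
    · rw [sqNorm_smul, sqNorm_smul, sqNorm_patterned, hτ4]
      field_simp
  · rintro _ ⟨u', v', huv', rfl⟩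
    have key : channelConv (τ⁻¹ • residueSum u') (τ • v') = p := by
      rw [channelConv_smul_left, channelConv_smul_right, channelConv_residueSum_left, huv',
        smul_smul, inv_mul_cancel₀ hτ.ne', one_smul]
    have h1 := hmin ⟨_, _, key, rfl⟩
    have h2 := sqNorm_residueSum_le u'
    rw [hτ4] at h2
    rw [sqNorm_smul, sqNorm_smul] at h1
    rw [div_le_iff₀ (by positivity)]
    calc sqNorm u + sqNorm v ≤ τ⁻¹ ^ 2 * sqNorm (residueSum u') + τ ^ 2 * sqNorm v' := h1
      _ ≤ τ⁻¹ ^ 2 * (τ ^ 4 * sqNorm u') + τ ^ 2 * sqNorm v' := by gcongr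
      _ = (sqNorm u' + sqNorm v') * τ ^ 2 := by field_simp

end Periodic

/-! ### The unitary Fourier transform and full-length kernels. -/

section Fourier

open Finset Matrix

/-- The entry `e^{-2πi d l / n}` of the Fourier matrix. -/
noncomputable def dftEntry {n : ℕ} (d l : Fin n) : ℂ :=
  Complex.exp (-2 * (Real.pi : ℂ) * Complex.I * (d.val : ℂ) * (l.val : ℂ) / (n : ℂ))

/-- The unitary Fourier matrix. -/
noncomputable def dftMatrix (n : ℕ) : Matrix (Fin n) (Fin n) ℂ :=
  Matrix.of fun d l => 1 / (√(n : ℝ) : ℂ) * dftEntry d l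

lemma unitaryDFT_eq_mulVec {n : ℕ} (a : Fin n → ℝ) :
    unitaryDFT a = dftMatrix n *ᵥ fun l => (a l : ℂ) := by
  ext d
  simp only [unitaryDFT, dftMatrix, dftEntry, Matrix.mulVec, dotProduct, Matrix.of_apply,
    Finset.mul_sum, mul_assoc]

lemma dftEntry_comm {n : ℕ} (d l : Fin n) : dftEntry d l = dftEntry l d := by
  unfold dftEntry; congr 1; ring

lemma isPrimitiveRoot_exp_neg (n : ℕ) [NeZero n] :
    IsPrimitiveRoot (Complex.exp (2 * Real.pi * Complex.I / n))⁻¹ n :=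
  (Complex.isPrimitiveRoot_exp n (NeZero.ne n)).inv

lemma dftEntry_eq_pow {n : ℕ} (d l : Fin n) :
    dftEntry d l = ((Complex.exp (2 * Real.pi * Complex.I / n))⁻¹ ^ l.val) ^ d.val := by
  rw [← pow_mul, ← Complex.exp_neg, ← Complex.exp_nat_mul, dftEntry]
  congr 1
  push_cast
  ring

lemma dftEntry_add_left {n : ℕ} [NeZero n] (d d' l : Fin n) :
    dftEntry (d + d') l = dftEntry d l * dftEntry d' l := by
  rw [dftEntry_eq_pow, dftEntry_eq_pow, dftEntry_eq_pow, ← pow_add, Fin.val_add,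
    ← pow_eq_pow_mod]
  rw [← pow_mul, mul_comm l.val n, pow_mul, (isPrimitiveRoot_exp_neg n).pow_eq_one, one_pow]

lemma dftEntry_add_right {n : ℕ} [NeZero n] (d l l' : Fin n) :
    dftEntry d (l + l') = dftEntry d l * dftEntry d l' := by
  rw [dftEntry_comm, dftEntry_add_left, dftEntry_comm l, dftEntry_comm l']

lemma dftEntry_zero_left {n : ℕ} [NeZero n] (l : Fin n) : dftEntry 0 l = 1 := by
  simp [dftEntry]

lemma star_dftEntry {n : ℕ} [NeZero n] (d l : Fin n) : star (dftEntry d l) = dftEntry (-d) l := by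
  have h1 : dftEntry (-d) l * dftEntry d l = 1 := by
    rw [← dftEntry_add_left, neg_add_cancel, dftEntry_zero_left]
  have h2 : star (dftEntry d l) * dftEntry d l = 1 := by
    have : ‖dftEntry d l‖ = 1 := by
      have h : dftEntry d l =
          Complex.exp (((-2 * Real.pi * d.val * l.val / n : ℝ) : ℂ) * Complex.I) := by
        unfold dftEntry; congr 1; push_cast; ring
      rw [h, Complex.norm_exp_ofReal_mul_I]
    change (starRingEnd ℂ) (dftEntry d l) * dftEntry d l = 1
    rw [mul_comm, Complex.mul_conj, Complex.normSq_eq_norm_sq, this]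
    norm_num
  exact mul_right_cancel₀ (right_ne_zero_of_mul_eq_one h1) (h2.trans h1.symm)

lemma sum_dftEntry {n : ℕ} [NeZero n] (l : Fin n) :
    ∑ d, dftEntry d l = if l = 0 then (n : ℂ) else 0 := by
  simp only [dftEntry_eq_pow]
  rw [Fin.sum_univ_eq_sum_range
    (fun d => ((Complex.exp (2 * Real.pi * Complex.I / n))⁻¹ ^ l.val) ^ d)]
  split_ifs with h
  · simp [h]
  · have hl : (Complex.exp (2 * Real.pi * Complex.I / n))⁻¹ ^ l.val ≠ 1 := by
      refine (isPrimitiveRoot_exp_neg n).pow_ne_one_of_pos_of_lt ?_ l.isLt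
      intro h0; exact h (Fin.ext (by simpa using h0))
    rw [geom_sum_eq hl, ← pow_mul, mul_comm l.val n, pow_mul, (isPrimitiveRoot_exp_neg n).pow_eq_one,
      one_pow, sub_self, zero_div]

lemma inv_sqrt_mul_inv_sqrt (n : ℕ) [NeZero n] :
    (1 / (√(n : ℝ) : ℂ)) * (1 / (√(n : ℝ) : ℂ)) * n = 1 := by
  have h : (√(n : ℝ) : ℂ) * (√(n : ℝ) : ℂ) = n := by
    rw [← Complex.ofReal_mul, Real.mul_self_sqrt (Nat.cast_nonneg n)]; simp
  have hn : (n : ℂ) ≠ 0 := by exact_mod_cast NeZero.ne n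
  rw [div_mul_div_comm, h]
  field_simp

lemma star_inv_sqrt (n : ℕ) : star (1 / (√(n : ℝ) : ℂ)) = 1 / (√(n : ℝ) : ℂ) := by
  change (starRingEnd ℂ) _ = _
  simp

lemma conjTranspose_dftMatrix_mul {n : ℕ} [NeZero n] : (dftMatrix n)ᴴ * dftMatrix n = 1 := by
  ext l l'
  rw [Matrix.mul_apply]
  have : ∀ d, (dftMatrix n)ᴴ l d * dftMatrix n d l' =
      (1 / (√(n : ℝ) : ℂ)) * (1 / (√(n : ℝ) : ℂ)) * dftEntry d (l' - l) := by
    intro d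
    rw [sub_eq_neg_add, dftEntry_add_right, dftEntry_comm d (-l), ← star_dftEntry, dftEntry_comm l]
    simp only [Matrix.conjTranspose_apply, dftMatrix, Matrix.of_apply, star_mul']
    rw [star_inv_sqrt]; ring
  simp only [this, ← Finset.mul_sum, sum_dftEntry, sub_eq_zero, Matrix.one_apply]
  by_cases h : l = l'
  · simp only [h, if_true]; exact inv_sqrt_mul_inv_sqrt n
  · simp [h, Ne.symm h]

lemma dftMatrix_mul_conjTranspose {n : ℕ} [NeZero n] : dftMatrix n * (dftMatrix n)ᴴ = 1 :=
  mul_eq_one_comm.1 conjTranspose_dftMatrix_mul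

lemma unitaryDFT_injective {n : ℕ} [NeZero n] :
    Function.Injective (unitaryDFT : (Fin n → ℝ) → Fin n → ℂ) := by
  intro a b h
  rw [unitaryDFT_eq_mulVec, unitaryDFT_eq_mulVec] at h
  have h' := congrArg ((dftMatrix n)ᴴ *ᵥ ·) h
  simp only [Matrix.mulVec_mulVec, conjTranspose_dftMatrix_mul, Matrix.one_mulVec] at h'
  ext l
  exact_mod_cast congrFun h' l

/-- Parseval's identity. -/
lemma sum_norm_sq_unitaryDFT {n : ℕ} [NeZero n] (a : Fin n → ℝ) :
    ∑ d, ‖unitaryDFT a d‖ ^ 2 = sqNorm a := by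
  have h : star (unitaryDFT a) ⬝ᵥ unitaryDFT a = star (fun l => (a l : ℂ)) ⬝ᵥ fun l => (a l : ℂ) := by
    rw [unitaryDFT_eq_mulVec, Matrix.star_mulVec, Matrix.dotProduct_mulVec, Matrix.vecMul_vecMul,
      conjTranspose_dftMatrix_mul, Matrix.vecMul_one]
  have h1 : ∀ z : ℂ, star z * z = ((‖z‖ ^ 2 : ℝ) : ℂ) := fun z => by
    change (starRingEnd ℂ) z * z = _
    rw [mul_comm, Complex.mul_conj, Complex.normSq_eq_norm_sq]
  simp only [dotProduct, Pi.star_apply, h1, ← Complex.ofReal_sum] at h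
  have h2 := Complex.ofReal_injective h
  rw [h2]
  simp [sqNorm]

lemma unitaryDFT_neg {n : ℕ} [NeZero n] (a : Fin n → ℝ) (d : Fin n) :
    unitaryDFT a (-d) = star (unitaryDFT a d) := by
  simp only [unitaryDFT_eq_mulVec, Matrix.mulVec, dotProduct, star_sum, dftMatrix, Matrix.of_apply,
    star_mul', ← star_dftEntry]
  refine Finset.sum_congr rfl fun l _ => ?_
  congr 2
  · change _ = (starRingEnd ℂ) _; simp
  · change _ = (starRingEnd ℂ) _; simp

/-- A conjugate-symmetric vector is the Fourier transform of a real one. -/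
lemma exists_unitaryDFT_eq {n : ℕ} [NeZero n] (b : Fin n → ℂ) (hb : ∀ d, b (-d) = star (b d)) :
    ∃ a : Fin n → ℝ, unitaryDFT a = b := by
  set z := (dftMatrix n)ᴴ *ᵥ b
  have hz : ∀ l, (starRingEnd ℂ) (z l) = z l := by
    intro l
    change star (z l) = z l
    simp only [z, Matrix.mulVec, dotProduct, star_sum, Matrix.conjTranspose_apply, dftMatrix,
      Matrix.of_apply, star_mul', star_star]
    rw [← Equiv.sum_comp (Equiv.neg (Fin n))]
    refine Finset.sum_congr rfl fun d _ => ?_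
    simp only [Equiv.neg_apply, hb, star_star, star_dftEntry, star_inv_sqrt]
  refine ⟨fun l => (z l).re, ?_⟩
  rw [unitaryDFT_eq_mulVec]
  have : (fun l => ((z l).re : ℂ)) = z := funext fun l => Complex.conj_eq_iff_re.1 (hz l)
  rw [this, Matrix.mulVec_mulVec, dftMatrix_mul_conjTranspose, Matrix.one_mulVec]

/-- The convolution theorem. -/
lemma unitaryDFT_channelConv {n : ℕ} [NeZero n] (u v : Fin n → ℝ) (d : Fin n) :
    unitaryDFT (channelConv u v) d = unitaryDFT u d * unitaryDFT v d := by
  have hk : ∀ k : Fin n, Fin.ofNat n k.val = k := fun k => Fin.ofNat_val_eq_self k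
  simp only [unitaryDFT_eq_mulVec, Matrix.mulVec, dotProduct, dftMatrix, Matrix.of_apply,
    channelConv_apply, hk]
  push_cast
  rw [Finset.sum_mul_sum]
  simp only [Finset.mul_sum]
  rw [Finset.sum_comm]
  refine Finset.sum_congr rfl fun k _ => ?_
  rw [← Equiv.sum_comp (Equiv.addRight k)]
  refine Finset.sum_congr rfl fun l _ => ?_
  simp only [Equiv.coe_addRight, add_sub_cancel_right, dftEntry_add_right]
  ring

/-- With full-length kernels the single-channel cost is twice the `ℓ₁` norm in Fourier space. -/
lemma isLeast_singleCosts_self {n : ℕ} [NeZero n] (p : Fin n → ℝ) :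
    IsLeast (singleCosts n p) (2 * l1Norm (unitaryDFT p)) := by
  constructor
  -- Equality in AM–GM needs factors of equal modulus `√|p̂|`; the phase goes into `v`. Conjugate
  -- symmetry makes both real, and where `p̂` vanishes division by zero gives the wanted `0`.
  · obtain ⟨u, hu⟩ := exists_unitaryDFT_eq (fun d => (√‖unitaryDFT p d‖ : ℂ)) fun d => by
      simp only [unitaryDFT_neg, norm_star]
      change _ = (starRingEnd ℂ) _
      simp
    obtain ⟨v, hv⟩ := exists_unitaryDFT_eq
      (fun d => unitaryDFT p d / (√‖unitaryDFT p d‖ : ℂ)) fun d => by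
        simp only [unitaryDFT_neg, norm_star, star_div₀]
        congr 1
        change _ = (starRingEnd ℂ) _
        simp
    refine ⟨u, v, unitaryDFT_injective (funext fun d => ?_), ?_⟩
    · rw [unitaryDFT_channelConv, hu, hv]
      by_cases h : unitaryDFT p d = 0
      · simp [h]
      · have : (√‖unitaryDFT p d‖ : ℂ) ≠ 0 := by
          exact_mod_cast (Real.sqrt_pos.2 (norm_pos_iff.2 h)).ne'
        field_simp
    · rw [← sum_norm_sq_unitaryDFT, ← sum_norm_sq_unitaryDFT, hu, hv, two_mul, l1Norm]
      congr 1 <;> refine Finset.sum_congr rfl fun d _ => ?_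
      · rw [Complex.norm_real, Real.norm_eq_abs, sq_abs, Real.sq_sqrt (norm_nonneg _)]
      · rw [norm_div, div_pow, Complex.norm_real, Real.norm_eq_abs, sq_abs,
          Real.sq_sqrt (norm_nonneg _), sq, mul_self_div_self]
  · rintro _ ⟨u, v, huv, rfl⟩
    rw [← sum_norm_sq_unitaryDFT, ← sum_norm_sq_unitaryDFT, ← Finset.sum_add_distrib, l1Norm,
      Finset.mul_sum]
    refine Finset.sum_le_sum fun d _ => ?_
    rw [← huv, unitaryDFT_channelConv, norm_mul, ← mul_assoc]
    exact two_mul_le_add_sq _ _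

end Fourier

/-! ### Assembly of the two cases. -/

theorem lemma4 (D P : ℕ) (hD : 0 < D) (hPD : P ∣ D) (p : Fin P → ℝ) :
    -- (a)
    (∀ K : ℕ, 1 ≤ K → K ≤ P → ∀ C : ℕ, 1 ≤ C →
      IsLeast (repCosts K C (patterned hPD p)) (inducedReg K C (patterned hPD p)) ∧
      IsLeast (repCosts K 1 p) (inducedReg K 1 p) ∧
      inducedReg K C (patterned hPD p) = (D : ℝ) / (P : ℝ) * inducedReg K 1 p) ∧
    -- (b)
    (∀ K : ℕ, P ≤ K → K ≤ D → ∀ T : ℕ, K = P * T → ∀ C : ℕ, 1 ≤ C →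
      IsLeast (repCosts K C (patterned hPD p)) (inducedReg K C (patterned hPD p)) ∧
      inducedReg K C (patterned hPD p) =
        2 * ((D : ℝ) / (Real.sqrt (T : ℝ) * (P : ℝ))) * l1Norm (unitaryDFT p) ∧
      2 * ((D : ℝ) / (Real.sqrt (T : ℝ) * (P : ℝ))) * l1Norm (unitaryDFT p) =
        2 * Real.sqrt ((D : ℝ) / (K : ℝ)) * l1Norm (unitaryDFT (patterned hPD p))) := by
  obtain ⟨M, rfl⟩ : ∃ M, D = M * P := ⟨D / P, (Nat.div_mul_cancel hPD).symm⟩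
  have hP0 : 0 < P := Nat.pos_of_mul_pos_left hD
  have hM0 : 0 < M := Nat.pos_of_mul_pos_right hD
  have : NeZero P := ⟨hP0.ne'⟩
  have : NeZero M := ⟨hM0.ne'⟩
  have hP : (0 : ℝ) < P := by exact_mod_cast hP0
  have hM : (0 : ℝ) < M := by exact_mod_cast hM0
  refine ⟨fun K hK1 _ C hC => ?_, fun K hPK _ T hKT C hC => ?_⟩
  · have : NeZero K := ⟨by omega⟩
    obtain ⟨r, hr⟩ := exists_isLeast_singleCosts (K := K) p
    obtain ⟨h1, h2⟩ := isLeast_repCosts_inducedReg hC (isLeast_singleCosts_patterned (M := M) hr)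
    obtain ⟨h3, h4⟩ := isLeast_repCosts_inducedReg le_rfl hr
    refine ⟨h1, h3, ?_⟩
    rw [h2, h4, Nat.cast_mul, mul_div_cancel_right₀ _ hP.ne']
  · obtain rfl : K = T * P := by rw [hKT, mul_comm]
    have hT0 : 0 < T := Nat.pos_of_ne_zero fun h => by subst h; omega
    have : NeZero T := ⟨hT0.ne'⟩
    have hT : (0 : ℝ) < T := by exact_mod_cast hT0
    obtain ⟨h1, h2⟩ := isLeast_repCosts_inducedReg hC (isLeast_singleCosts_patterned (M := M)
      (isLeast_singleCosts_mul (T := T) (isLeast_singleCosts_self p)))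
    refine ⟨h1, ?_, ?_⟩
    · rw [h2, Nat.cast_mul]; field_simp
    -- The cost of the patterned vector at kernel length `M * P` is computed in two ways; uniqueness
    -- of the minimum yields the factor `√M` between the `ℓ₁` norms.
    · have h := (isLeast_singleCosts_self (patterned hPD p)).unique
        (isLeast_singleCosts_patterned (M := M)
          (isLeast_singleCosts_mul (T := M) (isLeast_singleCosts_self p)))
      have hs : √(M : ℝ) ^ 2 = M := Real.sq_sqrt hM.le
      have hsM : 0 < √(M : ℝ) := Real.sqrt_pos.2 hM
      have hsT : 0 < √(T : ℝ) := Real.sqrt_pos.2 hT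
      have h' : l1Norm (unitaryDFT (patterned hPD p)) = √(M : ℝ) * l1Norm (unitaryDFT p) := by
        have : 2 * l1Norm (unitaryDFT (patterned hPD p)) =
            2 * (√(M : ℝ) * l1Norm (unitaryDFT p)) := by
          rw [h]
          nth_rewrite 1 [← hs]
          field_simp
        linarith
      rw [h', Nat.cast_mul, Nat.cast_mul, mul_div_mul_right _ _ hP.ne', mul_div_mul_right _ _ hP.ne',
        Real.sqrt_div hM.le]
      nth_rewrite 1 [← hs]
      field_simp
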